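/- Let $X$ be a semilattice, i.e. a set with an associative, commutative, idempotent binary operation $(x,y)\mapsto xy$, with its natural partial order ($x\le y$ iff $xy=x$), and let $X$ carry a Hausdorff topology $\tau_X$ for which the operation is separately continuous. Assume that $X$ is complete: every non-empty chain $C\subseteq X$ has an infimum and a supremum in $X$, and both lie in the closure $\overline C$. Assume moreover that at least one of the following holds: 1. the operation $X\times X\to X$ is (jointly) continuous; 2. $X$ is sequential: every non-closed set $A\subseteq X$ contains a sequence converging to a point of $X\setminus A$; 3. $X$ is a $\vec T_{2\delta}$-space: there is an injective continuous map $X\to Y$ into a $T_1$-space $Y$ such that, for every open $U\subseteq Y$ and $y\in U$, there is a countable family $\mathcal U$ of closed neighborhoods of $y$ with $\bigcap\mathcal U\subseteq U$; 4. $X$ is functionally Hausdorff: for any distinct $x,y\in X$ there is a continuous $f:X\to\mathbb R$ with $f(x)\ne f(y)$. Then $$\mathcal W_X\subseteq \mathrm{Lawson}_X\subseteq \mathcal Z_X\subseteq \tau_X .$$ Here $\mathcal W_X$ is the topology generated by the sets $h^{-1}(V)$, where $V\subseteq[0,1]$ is open and $h:X\to([0,1],\min)$ is a continuous homomorphism;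 $\mathcal Z_X$ is the topology generated by the complements of the closed subsemilattices of $X$; and $\mathrm{Lawson}_X$ is the topology generated by the Scott-open subsets of $X$ together with the sets $X\setminus\{y\in X: x\le y\}$, $x\in X$, where $U\subseteq X$ is Scott-open if it is an upper set and meets every non-empty up-directed set $D\subseteq X$ whose supremum exists and belongs to $U$. -/

import Mathlib

/-! A semilattice (commutative idempotent semigroup) is modelled by `SemilatticeInf`: the operation
`x * y` is `x ⊓ y`, and the order satisfies `x ≤ y ↔ x ⊓ y = x`. Subsemilattices (possibly empty)
are the sets `S` with `InfClosed S`. -/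

namespace TopologizedSemilattice

open Set TopologicalSpace

/-- The semilattice operation is separately continuous (one-sided by commutativity). -/
def IsSemitopological (X : Type*) [SemilatticeInf X] [TopologicalSpace X] : Prop :=
  ∀ a : X, Continuous fun x : X => a ⊓ x

/-- Every nonempty chain `C` has an infimum and a supremum in `X`, both lying in the closure
of `C`. -/
def IsCompleteSemilattice (X : Type*) [SemilatticeInf X] [TopologicalSpace X] : Prop :=
  ∀ C : Set X, C.Nonempty → IsChain (· ≤ ·) C →
    (∃ a ∈ closure C, IsGLB C a) ∧ (∃ b ∈ closure C, IsLUB C b)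

/-- The weak• topology `𝒵_X`, generated by the complements of closed subsemilattices. -/
abbrev zariskiTopology (X : Type*) [SemilatticeInf X] [TopologicalSpace X] : TopologicalSpace X :=
  generateFrom {U | ∃ S : Set X, IsClosed S ∧ InfClosed S ∧ U = Sᶜ}

/-- The `[0,1]`-weak topology `𝒲_X`, generated by the preimages of open sets of `[0,1]` under
continuous semilattice homomorphisms `X → ([0,1], min)`. -/
abbrev intervalWeakTopology (X : Type*) [SemilatticeInf X] [TopologicalSpace X] :
    TopologicalSpace X :=
  generateFrom {U | ∃ h : X → unitInterval, Continuous h ∧ (∀ x y, h (x ⊓ y) = min (h x) (h y)) ∧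
    ∃ V : Set unitInterval, IsOpen V ∧ U = h ⁻¹' V}

/-- A `T_{2δ}`-space: `T₁`, and every open `U` containing `x` contains the intersection of a
countable family of closed neighbourhoods of `x`. -/
def IsT2Delta (Y : Type*) [TopologicalSpace Y] : Prop :=
  T1Space Y ∧ ∀ (U : Set Y) (x : Y), IsOpen U → x ∈ U →
    ∃ F : Set (Set Y), F.Countable ∧ (∀ N ∈ F, IsClosed N ∧ N ∈ nhds x) ∧ ⋂₀ F ⊆ U

/-- `X` admits a continuous injection into a `T_{2δ}`-space. Restricting to spaces in the universe
of `X` loses nothing: `X` with the topology induced by such an injection is again `T_{2δ}`. -/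
def IsVecT2Delta.{u} (X : Type u) [TopologicalSpace X] : Prop :=
  ∃ (Y : Type u) (_ : TopologicalSpace Y), IsT2Delta Y ∧
    ∃ f : X → Y, Continuous f ∧ Function.Injective f

/-- Distinct points are separated by a continuous real-valued function. -/
def IsFunctionallyHausdorff (X : Type*) [TopologicalSpace X] : Prop :=
  ∀ x y : X, x ≠ y → ∃ f : X → ℝ, Continuous f ∧ f x ≠ f y

end TopologizedSemilattice

open scoped Topology

/-! ### Order completeness derived from completeness of chains. -/

namespace TopologizedSemilattice

open Set Filter Topology

variable {X : Type*} [SemilatticeInf X]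

/-! The core is that every Scott-closed set `L` is closed in `X`; being a lower set, it is then a
closed subsemilattice, which gives the middle inclusion. The first inclusion uses that a closed
lower set is Scott-closed (`IsCompleteSemilattice.dirSupClosed`) and that a nonempty closed
subsemilattice has a least element (`exists_isLeast`).

To show that a point `x` of the closure of `L` lies in `L`, choose points `y i` of `L` one after
another so that the infima of `x` with segments of the `y i` stay in prescribed sets. Infima of
tails then lie in `L` and increase with the starting index; their supremum lies in `L`, below `x`,
and in the closures of the prescribed sets (`exists_isLUB_tails`). With sequences this handles
countably many neighbourhoods of `x`. To force the supremum to be `x` itself, cases 1, 3 and 4 use a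
shift-stable family of closed sets whose only common point is `x`, and induct on the cardinality of
subfamilies (`exists_mem_iInter_of_shift`). Case 2 instead maximizes limits inferior along countably
generated filters. -/

/-- A set containing every existing supremum of a nonempty chain of its elements. -/
def ChainSupClosed (S : Set X) : Prop :=
  ∀ ⦃C : Set X⦄, C ⊆ S → C.Nonempty → IsChain (· ≤ ·) C → ∀ ⦃a⦄, IsLUB C a → a ∈ S

theorem isChain_iff_le {C : Set X} :
    IsChain (· ≤ ·) C ↔ ∀ a ∈ C, ∀ b ∈ C, a ≤ b ∨ b ≤ a := by
  constructor
  · intro h a ha b hb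
    exact h.total ha hb
  · intro h a ha b hb _
    exact h a ha b hb

theorem _root_.DirSupClosed.chainSupClosed {S : Set X} (hS : DirSupClosed S) :
    ChainSupClosed S :=
  fun _ hCS hC hch _ ha => hS hCS hC hch.directedOn ha

variable [TopologicalSpace X]

namespace IsSemitopological

variable (hs : IsSemitopological X)
include hs

theorem isClosed_Ici [T1Space X] (a : X) : IsClosed (Ici a) := by
  have : Ici a = (fun x => a ⊓ x) ⁻¹' {a} := by
    ext y; simp
  rw [this]
  exact isClosed_singleton.preimage (hs a)

theorem isClosed_Iic [T2Space X] (a : X) : IsClosed (Iic a) := by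
  have : Iic a = {x | a ⊓ x = x} := by
    ext y; simp
  rw [this]
  exact isClosed_eq (hs a) continuous_id

theorem infClosed_closure {A : Set X} (hA : InfClosed A) : InfClosed (closure A) := by
  have h1 : ∀ a ∈ A, ∀ b ∈ closure A, a ⊓ b ∈ closure A := fun a ha b hb =>
    map_mem_closure (hs a) hb fun c hc => hA ha hc
  intro a ha b hb
  have := map_mem_closure (hs b) ha (t := closure A) fun c hc => by
    rw [inf_comm]; exact h1 c hc b hb
  rwa [closure_closure, inf_comm] at this

end IsSemitopological

namespace IsCompleteSemilattice

variable (hc : IsCompleteSemilattice X)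
include hc

theorem isGLB_mem_closure {C : Set X} (hC : C.Nonempty) (hch : IsChain (· ≤ ·) C) {a : X}
    (ha : IsGLB C a) : a ∈ closure C := by
  obtain ⟨⟨b, hb, hbC⟩, -⟩ := hc C hC hch
  rwa [ha.unique hbC]

theorem isLUB_mem_closure {C : Set X} (hC : C.Nonempty) (hch : IsChain (· ≤ ·) C) {a : X}
    (ha : IsLUB C a) : a ∈ closure C := by
  obtain ⟨-, b, hb, hbC⟩ := hc C hC hch
  rwa [ha.unique hbC]

theorem chainSupClosed_of_isClosed {S : Set X} (hS : IsClosed S) : ChainSupClosed S :=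
  fun _ hCS hC hch _ ha => closure_minimal hCS hS (hc.isLUB_mem_closure hC hch ha)

/-- Zorn's lemma gives a minimal `m`, since infima of chains stay in the closed set; then `m ⊓ b ∈
A` forces `m ≤ b`. -/
theorem exists_isLeast {A : Set X} (hA : A.Nonempty) (hAc : IsClosed A) (hAi : InfClosed A) :
    ∃ a, IsLeast A a := by
  obtain ⟨x, hx⟩ := hA
  obtain ⟨m, -, hm⟩ := zorn_le_nonempty₀ (α := Xᵒᵈ) (OrderDual.ofDual ⁻¹' A) (fun C hCA hC y hy => by
    obtain ⟨⟨a, ha, haC⟩, -⟩ := hc (OrderDual.toDual ⁻¹' C) ⟨_, hy⟩ (by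
      rw [isChain_iff_le]
      intro a ha b hb
      exact (hC.total ha hb).symm)
    exact ⟨OrderDual.toDual a, closure_minimal (fun z hz => hCA hz) hAc ha,
      fun z hz => haC.1 hz⟩) (OrderDual.toDual x) hx
  refine ⟨OrderDual.ofDual m, hm.1, fun b hb => ?_⟩
  have h1 : OrderDual.toDual (OrderDual.ofDual m ⊓ b) ≤ m :=
    hm.2 (y := OrderDual.toDual (OrderDual.ofDual m ⊓ b)) (hAi hm.1 hb)
      (show OrderDual.ofDual m ⊓ b ≤ OrderDual.ofDual m from inf_le_left)
  exact le_trans (show OrderDual.ofDual m ≤ OrderDual.ofDual m ⊓ b from h1) inf_le_right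

variable [T2Space X] (hs : IsSemitopological X)
include hs

theorem exists_isGLB {A : Set X} (hA : A.Nonempty) : ∃ a, IsGLB A a := by
  obtain ⟨a, ha, hle⟩ := hc.exists_isLeast (A := closure (infClosure A))
    (hA.mono (subset_infClosure.trans subset_closure)) isClosed_closure
    (hs.infClosed_closure infClosed_infClosure)
  refine ⟨a, fun b hb => hle (subset_closure (subset_infClosure hb)), fun b hb => ?_⟩
  have : infClosure A ⊆ Ici b :=
    infClosure_min (fun c hc => hb hc) (fun c hc d hd => le_inf hc hd)
  exact closure_minimal this (hs.isClosed_Ici b) ha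

theorem exists_isLUB {A : Set X} (hA : BddAbove A) : ∃ a, IsLUB A a := by
  obtain ⟨a, ha⟩ := hc.exists_isGLB hs (A := upperBounds A) hA
  exact ⟨a, isGLB_upperBounds.1 ha⟩

/-- In a complete semilattice, chain-completeness of a lower set implies directed completeness. -/
theorem dirSupClosed {S : Set X} (hS : IsLowerSet S) (hSc : ChainSupClosed S) :
    DirSupClosed S := by
  intro d hdS hd hdir a ha
  have hj : ∀ u v, u ≤ a → v ≤ a → ∃ w, IsLUB {u, v} w := fun u v hu hv =>
    hc.exists_isLUB hs ⟨a, by simp [upperBounds, hu, hv]⟩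
  have hmem : (lowerClosure d : Set X) ∈
      {M : Set X | M ⊆ S ∧ M ⊆ Iic a ∧ IsLowerSet M ∧ DirectedOn (· ≤ ·) M} := by
    refine ⟨?_, ?_, (lowerClosure d).lower, ?_⟩
    · rintro y ⟨z, hz, hyz⟩
      exact hS hyz (hdS hz)
    · rintro y ⟨z, hz, hyz⟩
      exact le_trans hyz (ha.1 hz)
    · rintro y ⟨z, hz, hyz⟩ y' ⟨z', hz', hyz'⟩
      obtain ⟨w, hw, h1, h2⟩ := hdir z hz z' hz'
      exact ⟨w, subset_lowerClosure hw, le_trans hyz h1, le_trans hyz' h2⟩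
  -- Enlarge `d` to a maximal directed lower set `M` in `S` below `a`. Maximality will make `M`
  -- chain-complete.
  obtain ⟨M, hdM, hM⟩ := zorn_subset_nonempty
    {M : Set X | M ⊆ S ∧ M ⊆ Iic a ∧ IsLowerSet M ∧ DirectedOn (· ≤ ·) M}
    (fun c hcS hch _ => ⟨⋃₀ c, ⟨sUnion_subset fun s hs => (hcS hs).1,
      sUnion_subset fun s hs => (hcS hs).2.1, isLowerSet_sUnion fun s hs => (hcS hs).2.2.1,
      directedOn_sUnion hch.directedOn fun s hs => (hcS hs).2.2.2⟩,
      fun s hs => subset_sUnion_of_mem hs⟩) (lowerClosure d) hmem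
  obtain ⟨hMS, hMa, hMl, hMd⟩ := hM.1
  have hdM' : d ⊆ M := subset_lowerClosure.trans hdM
  have hMc : ChainSupClosed M := by
    intro C hCM hC hch s hsC
    have hsa : s ≤ a := hsC.2 fun c hc => hMa (hCM hc)
    have hMM : M ⊆ {y | ∃ m ∈ M, ∃ w, IsLUB {s, m} w ∧ y ≤ w} := fun m hm => by
      obtain ⟨w, hw⟩ := hj s m hsa (hMa hm)
      exact ⟨m, hm, w, hw, hw.1 (by simp)⟩
    -- Adjoining `s` to `M` keeps it inside `S`, because the join of `s` and `m` is the supremum of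
    -- the chain of joins of `m` with elements of `C`.
    have key : {y | ∃ m ∈ M, ∃ w, IsLUB {s, m} w ∧ y ≤ w} ⊆ M := by
      refine hM.2 ⟨?_, ?_, ?_, ?_⟩ hMM
      · rintro y ⟨m, hm, w, hw, hyw⟩
        refine hS hyw ?_
        have hj' : ∀ c ∈ C, ∃ v, IsLUB {c, m} v := fun c hc =>
          hj c m (hMa (hCM hc)) (hMa hm)
        refine hSc (C := {v | ∃ c ∈ C, IsLUB {c, m} v}) ?_ ?_ ?_ ?_
        · rintro v ⟨c, hc, hv⟩
          obtain ⟨u, hu, h1, h2⟩ := hMd c (hCM hc) m hm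
          exact hS (hv.2 (by simp [upperBounds, h1, h2])) (hMS hu)
        · obtain ⟨c, hc⟩ := hC
          obtain ⟨v, hv⟩ := hj' c hc
          exact ⟨v, c, hc, hv⟩
        · rw [isChain_iff_le]
          have mono : ∀ c c' v v', IsLUB {c, m} v → IsLUB {c', m} v' → c ≤ c' → v ≤ v' := by
            intro c c' v v' hv hv' hcc
            refine hv.2 ?_
            simpa [upperBounds] using ⟨hcc.trans (hv'.1 (by simp)), hv'.1 (by simp)⟩
          rintro v ⟨c, hc, hv⟩ v' ⟨c', hc', hv'⟩
          rcases hch.total hc hc' with h | h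
          · exact Or.inl (mono _ _ _ _ hv hv' h)
          · exact Or.inr (mono _ _ _ _ hv' hv h)
        · constructor
          · rintro v ⟨c, hc, hv⟩
            refine hv.2 ?_
            simpa [upperBounds] using ⟨(hsC.1 hc).trans (hw.1 (by simp)), hw.1 (by simp)⟩
          · intro b hb
            have hcb : ∀ c ∈ C, c ≤ b ∧ m ≤ b := fun c hc => by
              obtain ⟨v, hv⟩ := hj' c hc
              have := hb ⟨c, hc, hv⟩
              exact ⟨(hv.1 (by simp)).trans this, (hv.1 (by simp)).trans this⟩
            obtain ⟨c, hc⟩ := hC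
            refine hw.2 ?_
            simpa [upperBounds] using ⟨hsC.2 fun c hc => (hcb c hc).1, (hcb c hc).2⟩
      · rintro y ⟨m, hm, w, hw, hyw⟩
        exact hyw.trans (hw.2 (by simpa [upperBounds] using ⟨hsa, hMa hm⟩))
      · rintro y y' hyy ⟨m, hm, w, hw, hyw⟩
        exact ⟨m, hm, w, hw, hyy.trans hyw⟩
      · rintro y ⟨m, hm, w, hw, hyw⟩ y' ⟨m', hm', w', hw', hyw'⟩
        obtain ⟨n, hn, h1, h2⟩ := hMd m hm m' hm'
        obtain ⟨v, hv⟩ := hj s n hsa (hMa hn)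
        refine ⟨v, ⟨n, hn, v, hv, le_rfl⟩, hyw.trans (hw.2 ?_), hyw'.trans (hw'.2 ?_)⟩
        · simpa [upperBounds] using ⟨hv.1 (by simp), h1.trans (hv.1 (by simp))⟩
        · simpa [upperBounds] using ⟨hv.1 (by simp), h2.trans (hv.1 (by simp))⟩
    obtain ⟨m, hm⟩ := hd
    obtain ⟨w, hw⟩ := hj s m hsa (hMa (hdM' hm))
    exact key ⟨m, hdM' hm, w, hw, hw.1 (by simp)⟩
  obtain ⟨x, hx⟩ := hd
  -- A maximal element of the directed set `M` is its greatest element, so it bounds `d` and hence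
  -- `a`.
  obtain ⟨g, -, hg⟩ := zorn_le_nonempty₀ M (fun C hCM hC y hy => by
    obtain ⟨-, b, -, hb⟩ := hc C ⟨y, hy⟩ hC
    exact ⟨b, hMc hCM ⟨y, hy⟩ hC hb, hb.1⟩) x (hdM' hx)
  refine hS (ha.2 fun y hy => ?_) (hMS hg.1)
  obtain ⟨w, hw, h1, h2⟩ := hMd g hg.1 y (hdM' hy)
  exact h2.trans (hg.2 hw h1)

end IsCompleteSemilattice

end TopologizedSemilattice

/-! ### Comparison of the Lawson, Zariski and interval weak topologies. -/

namespace TopologizedSemilattice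

open Set Filter Topology TopologicalSpace

variable {X : Type*} [SemilatticeInf X]

theorem isOpen_lawson_compl_Ici (x : X) : IsOpen[lawson X] (Ici x)ᶜ := by
  have h : lawson X ≤ lower X := inf_le_left
  exact h _ (TopologicalSpace.isOpen_generateFrom_of_mem ⟨x, rfl⟩)

theorem isOpen_scott_iff {U : Set X} :
    IsOpen[scott X univ] U ↔ IsUpperSet U ∧ DirSupInacc U := by
  let : TopologicalSpace X := scott X univ
  have : IsScott X univ := ⟨rfl⟩
  rw [IsScott.isOpen_iff_isUpperSet_and_dirSupInaccOn (D := univ), dirSupInaccOn_univ]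

theorem isOpen_lawson_of_compl {S : Set X} (hS : IsLowerSet S) (hSc : DirSupClosed S) :
    IsOpen[lawson X] Sᶜ := by
  have h : lawson X ≤ scott X univ := inf_le_right
  exact h _ (isOpen_scott_iff.2 ⟨hS.compl, hSc.compl⟩)

/-- If all Scott-closed sets are closed, the Lawson topology is coarser than `𝒵_X`. -/
theorem zariskiTopology_le_lawson [TopologicalSpace X] [T1Space X] (hs : IsSemitopological X)
    (h : ∀ L : Set X, IsLowerSet L → DirSupClosed L → IsClosed L) :
    zariskiTopology X ≤ lawson X := by
  refine le_inf (le_generateFrom ?_) fun U hU => ?_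
  · rintro _ ⟨x, rfl⟩
    exact isOpen_generateFrom_of_mem ⟨Ici x, hs.isClosed_Ici x,
      fun a ha b hb => le_inf ha hb, rfl⟩
  · obtain ⟨hU, hUd⟩ := isOpen_scott_iff.1 hU
    exact isOpen_generateFrom_of_mem ⟨Uᶜ, h _ hU.compl hUd.compl,
      fun a ha b _ => hU.compl inf_le_left ha, (compl_compl U).symm⟩

variable [TopologicalSpace X]

theorem le_zariskiTopology : ‹TopologicalSpace X› ≤ zariskiTopology X := by
  refine le_generateFrom ?_
  rintro _ ⟨S, hS, -, rfl⟩
  exact hS.isOpen_compl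

/-- It suffices to pull back open rays: the complement of one preimage is a closed lower set, that
of the other a closed subsemilattice, hence empty or of the form `Ici a`. -/
theorem IsCompleteSemilattice.lawson_le_intervalWeakTopology [T2Space X]
    (hc : IsCompleteSemilattice X) (hs : IsSemitopological X) :
    lawson X ≤ intervalWeakTopology X := by
  refine le_generateFrom ?_
  rintro _ ⟨h, hcont, hinf, V, hV, rfl⟩
  have hmono : Monotone h := fun a b hab => by
    have := hinf a b
    rw [inf_eq_left.2 hab] at this
    rw [this]; exact min_le_right _ _
  suffices H : @Continuous X unitInterval (lawson X) _ h from
    @Continuous.isOpen_preimage X unitInterval (lawson X) _ h H V hV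
  rw [OrderTopology.topology_eq_generate_intervals (α := unitInterval)]
  refine continuous_generateFrom_iff.2 ?_
  rintro _ ⟨c, rfl | rfl⟩
  · have : h ⁻¹' Ioi c = (h ⁻¹' Iic c)ᶜ := by ext; simp
    rw [this]
    have hl : IsLowerSet (h ⁻¹' Iic c) := fun a b hba ha => (hmono hba).trans ha
    exact isOpen_lawson_of_compl hl (hc.dirSupClosed hs hl
      (hc.chainSupClosed_of_isClosed (isClosed_Iic.preimage hcont)))
  · have : h ⁻¹' Iio c = (h ⁻¹' Ici c)ᶜ := by ext; simp
    rw [this]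
    rcases (h ⁻¹' Ici c).eq_empty_or_nonempty with he | hne
    · rw [he, compl_empty]; exact @isOpen_univ X (lawson X)
    · obtain ⟨a, ha⟩ := hc.exists_isLeast hne (isClosed_Ici.preimage hcont)
        (fun x hx y hy => by
          simp only [mem_preimage, mem_Ici] at hx hy ⊢
          rw [hinf]; exact le_min hx hy)
      have : h ⁻¹' Ici c = Ici a :=
        Subset.antisymm (fun b hb => ha.2 hb) fun b hb => le_trans (ha.1) (hmono hb)
      rw [this]
      exact isOpen_lawson_compl_Ici a

end TopologizedSemilattice

/-! ### Infima of tails of transfinite sequences. -/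

namespace TopologizedSemilattice

open Set Filter Topology

/-- Well-founded recursion with choice. -/
theorem exists_wellFounded_choice {ι X : Type*} [LT ι] [WellFoundedLT ι] [Nonempty X]
    (Good : (i : ι) → ((j : ι) → j < i → X) → X → Prop) :
    ∃ y : ι → X, ∀ i, (∃ z, Good i (fun j _ => y j) z) → Good i (fun j _ => y j) (y i) := by
  classical
  let F : (i : ι) → ((j : ι) → j < i → X) → X := fun i f => Classical.epsilon (Good i f)
  refine ⟨(wellFounded_lt (α := ι)).fix F, fun i hi => ?_⟩
  have h := (wellFounded_lt (α := ι)).fix_eq F i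
  rw [h]
  exact Classical.epsilon_spec hi

variable {X : Type*} [SemilatticeInf X] [TopologicalSpace X]

section Tail

variable {ι : Type*} [LinearOrder ι]

/-- The set of the `y i` with `i ∈ S`, `γ ≤ i`, together with a top element `x`. -/
def tailSet (x : X) (y : ι → X) (γ : ι) (S : Set ι) : Set X :=
  insert x {w | ∃ i ∈ S, γ ≤ i ∧ y i = w}

variable (hc : IsCompleteSemilattice X) {I : Set X → X}
  (hI : ∀ A : Set X, A.Nonempty → IsGLB A (I A))
include hI

omit [TopologicalSpace X] in
theorem le_tail_iff {x : X} {y : ι → X} {γ : ι} {S : Set ι} {b : X} :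
    b ≤ I (tailSet x y γ S) ↔ b ≤ x ∧ ∀ i ∈ S, γ ≤ i → b ≤ y i := by
  rw [le_isGLB_iff (hI (tailSet x y γ S) (insert_nonempty _ _))]
  constructor
  · intro h
    exact ⟨h (mem_insert _ _), fun i hi hγ => h (mem_insert_of_mem _ ⟨i, hi, hγ, rfl⟩)⟩
  · rintro ⟨h1, h2⟩ w (rfl | ⟨i, hi, hγ, rfl⟩)
    · exact h1
    · exact h2 i hi hγ

omit [TopologicalSpace X] in
theorem tail_Iio_self {x : X} {y : ι → X} (γ : ι) : I (tailSet x y γ (Iio γ)) = x :=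
  le_antisymm ((le_tail_iff hI).1 le_rfl).1
    ((le_tail_iff hI).2 ⟨le_rfl, fun _ hi hγ => absurd hi (not_lt.2 hγ)⟩)

include hc

/-- The tail infimum is the infimum of a decreasing chain, formed by the infima over the segments
from `γ` to `δ`; these all lie in `W β`. -/
theorem tail_mem_closure {x : X} {y : ι → X} {W : ι → Set X}
    {S : Set ι} (hS : IsLowerSet S)
    (hW : ∀ β γ, ∀ δ ∈ S, β ≤ γ → γ ≤ δ → I (tailSet x y γ (Iio δ)) ⊓ y δ ∈ W β) {β γ : ι} (hβγ : β ≤ γ) (hγ : γ ∈ S) :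
    I (tailSet x y γ S) ∈ closure (W β) := by
  have hle : ∀ {δ b}, b ≤ I (tailSet x y γ (Iio δ)) ⊓ y δ ↔
      b ≤ x ∧ (∀ i < δ, γ ≤ i → b ≤ y i) ∧ b ≤ y δ := fun {δ b} => by
    rw [le_inf_iff, le_tail_iff hI]; simp [and_assoc]
  let C : Set X := {w | ∃ δ ∈ S, γ ≤ δ ∧ I (tailSet x y γ (Iio δ)) ⊓ y δ = w}
  have hCW : C ⊆ W β := by
    rintro _ ⟨δ, hδS, hδ, rfl⟩
    exact hW β γ δ hδS hβγ hδ
  refine closure_mono hCW (hc.isGLB_mem_closure (C := C) ⟨_, γ, hγ, le_rfl, rfl⟩ ?_ ⟨?_, ?_⟩)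
  · rw [isChain_iff_le]
    have anti : ∀ δ δ', γ ≤ δ → δ ≤ δ' →
        I (tailSet x y γ (Iio δ')) ⊓ y δ' ≤ I (tailSet x y γ (Iio δ)) ⊓ y δ := by
      intro δ δ' hγδ hδ
      obtain ⟨h1, h2, h3⟩ := hle.1 (le_refl (I (tailSet x y γ (Iio δ')) ⊓ y δ'))
      refine hle.2 ⟨h1, fun i hi => h2 i (hi.trans_le hδ), ?_⟩
      rcases hδ.lt_or_eq with h | rfl
      · exact h2 δ h hγδ
      · exact h3
    rintro _ ⟨δ, -, hδ, rfl⟩ _ ⟨δ', -, hδ', rfl⟩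
    rcases le_total δ δ' with h | h
    · exact Or.inr (anti _ _ hδ h)
    · exact Or.inl (anti _ _ hδ' h)
  · rintro _ ⟨δ, hδS, hδ, rfl⟩
    obtain ⟨h1, h2⟩ := (le_tail_iff hI).1 (le_refl (I (tailSet x y γ S)))
    exact hle.2 ⟨h1, fun i hi => h2 i (hS hi.le hδS), h2 δ hδS hδ⟩
  · intro b hb
    refine (le_tail_iff hI).2 ⟨(hle.1 (hb ⟨γ, hγ, le_rfl, rfl⟩)).1, fun i hi hγi => ?_⟩
    exact (hle.1 (hb ⟨i, hi, hγi, rfl⟩)).2.2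

theorem exists_isLUB_tails [Nonempty ι] {L : Set X} (hL : IsLowerSet L) (hLc : ChainSupClosed L)
    {x : X} {y : ι → X} (hyL : ∀ i, y i ∈ L) {W : ι → Set X}
    (hW : ∀ β γ δ, β ≤ γ → γ ≤ δ → I (tailSet x y γ (Iio δ)) ⊓ y δ ∈ W β) :
    ∃ s ∈ L, s ≤ x ∧ IsLUB (range fun γ => I (tailSet x y γ univ)) s ∧
      ∀ β, s ∈ closure (W β) := by
  have mono : Monotone fun γ => I (tailSet x y γ univ) := fun γ γ' h => by
    obtain ⟨h1, h2⟩ := (le_tail_iff hI).1 (le_refl (I (tailSet x y γ univ)))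
    exact (le_tail_iff hI).2 ⟨h1, fun i hi hγ => h2 i hi (h.trans hγ)⟩
  have hch : IsChain (· ≤ ·) (range fun γ => I (tailSet x y γ univ)) := by
    rw [isChain_iff_le]
    rintro _ ⟨γ, rfl⟩ _ ⟨γ', rfl⟩
    rcases le_total γ γ' with h | h
    · exact Or.inl (mono h)
    · exact Or.inr (mono h)
  obtain ⟨-, s, -, hs⟩ := hc _ (range_nonempty _) hch
  refine ⟨s, hLc ?_ (range_nonempty _) hch hs, ?_, hs, fun β => ?_⟩
  · rintro _ ⟨γ, rfl⟩
    exact hL (((le_tail_iff hI).1 le_rfl).2 γ trivial le_rfl) (hyL γ)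
  · refine hs.2 ?_
    rintro _ ⟨γ, rfl⟩
    exact ((le_tail_iff hI).1 le_rfl).1
  -- Dropping the tails that start before `β` does not change the supremum.
  · have h1 : IsLUB ((fun γ => I (tailSet x y γ univ)) '' Ici β) s := by
      refine ⟨fun _ h => hs.1 (image_subset_range _ _ h), fun b hb => hs.2 ?_⟩
      rintro _ ⟨γ, rfl⟩
      exact (mono (le_max_left γ β)).trans (hb ⟨max γ β, le_max_right _ _, rfl⟩)
    have h2 : (fun γ => I (tailSet x y γ univ)) '' Ici β ⊆ closure (W β) := by
      rintro _ ⟨γ, hγ, rfl⟩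
      exact tail_mem_closure hc hI isLowerSet_univ (fun β γ δ _ => hW β γ δ) hγ trivial
    exact closure_minimal h2 isClosed_closure (hc.isLUB_mem_closure
      (nonempty_Ici.image _) (hch.mono (image_subset_range _ _)) h1)

end Tail

/-! ### Sequences with controlled limit inferior. -/

section Sequence

/-- Stage `n` imposes finitely many open conditions on `y n`. Each holds at `x`, so by separate
continuity it holds eventually along `G`. The resulting `z` is the limit inferior of `y`. -/
theorem exists_sequence_isLUB_mem_closure [T2Space X]
    (hc : IsCompleteSemilattice X) (hs : IsSemitopological X)
    {L : Set X} (hL : IsLowerSet L) (hLc : ChainSupClosed L) {x : X} {G : Filter X} [NeBot G]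
    (hG : G ≤ 𝓝 x) {E : ℕ → Set X} (hE : ∀ n, E n ∈ G) (hEL : ∀ n, E n ⊆ L ∩ Iic x)
    {U : ℕ → Set X} (hU : ∀ n, IsOpen (U n)) (hxU : ∀ n, x ∈ U n) :
    ∃ y : ℕ → X, (∀ n, y n ∈ E n) ∧ ∃ z ∈ L, z ≤ x ∧
      IsLUB {b | ∀ᶠ n in atTop, b ≤ y n} z ∧ ∀ n, z ∈ closure (U n) := by
  have : Nonempty X := ⟨x⟩
  choose! I hI using fun (A : Set X) (hA : A.Nonempty) => hc.exists_isGLB hs hA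
  obtain ⟨y, hy⟩ := exists_wellFounded_choice (ι := ℕ) fun n f z => z ∈ E n ∧
    ∀ β γ, β ≤ γ → γ ≤ n → I (insert x {w | ∃ i, ∃ h : i < n, γ ≤ i ∧ f i h = w}) ⊓ z ∈ U β
  have hset : ∀ γ n, {w | ∃ i, ∃ _ : i < n, γ ≤ i ∧ y i = w} =
      {w | ∃ i ∈ Iio n, γ ≤ i ∧ y i = w} := fun γ n => by
    ext; simp [and_left_comm]
  simp only [hset] at hy
  change ∀ n, (∃ z, z ∈ E n ∧ ∀ β γ, β ≤ γ → γ ≤ n → I (tailSet x y γ (Iio n)) ⊓ z ∈ U β) →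
    (y n ∈ E n ∧ ∀ β γ, β ≤ γ → γ ≤ n → I (tailSet x y γ (Iio n)) ⊓ y n ∈ U β) at hy
  have hgood : ∀ n, y n ∈ E n ∧ ∀ β γ, β ≤ γ → γ ≤ n → I (tailSet x y γ (Iio n)) ⊓ y n ∈ U β := by
    have step : ∀ n, (∀ β γ, β ≤ γ → γ ≤ n → I (tailSet x y γ (Iio n)) ∈ U β) →
        (y n ∈ E n ∧ ∀ β γ, β ≤ γ → γ ≤ n → I (tailSet x y γ (Iio n)) ⊓ y n ∈ U β) := by
      intro n h
      refine hy n ?_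
      have hfin : ∀ᶠ z in G, ∀ β ≤ n, ∀ γ ≤ n, β ≤ γ → I (tailSet x y γ (Iio n)) ⊓ z ∈ U β := by
        refine (eventually_all_finite (finite_Iic n)).2 fun β _ =>
          (eventually_all_finite (finite_Iic n)).2 fun γ hγ => ?_
        by_cases hβγ : β ≤ γ
        · have hx : I (tailSet x y γ (Iio n)) ⊓ x ∈ U β := by
            rw [inf_eq_left.2 ((le_tail_iff hI).1 le_rfl).1]
            exact h β γ hβγ hγ
          have := ((hs (I (tailSet x y γ (Iio n)))).tendsto x).eventually ((hU β).mem_nhds hx)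
          exact (this.filter_mono hG).mono fun z hz _ => hz
        · exact Eventually.of_forall fun _ h => (hβγ h).elim
      obtain ⟨z, hz, hzE⟩ := (hfin.and (hE n)).exists
      exact ⟨z, hzE, fun β γ hβγ hγ => hz β (hβγ.trans hγ) γ hγ hβγ⟩
    intro n
    induction n with
    | zero =>
      refine step 0 fun β γ _ hγ => ?_
      obtain rfl : γ = 0 := by omega
      rw [tail_Iio_self hI]; exact hxU β
    | succ n ih =>
      refine step (n + 1) fun β γ hβγ hγ => ?_
      rcases hγ.lt_or_eq with h | rfl
      · have : I (tailSet x y γ (Iio (n + 1))) = I (tailSet x y γ (Iio n)) ⊓ y n := by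
          refine eq_of_forall_le_iff fun b => ?_
          rw [le_inf_iff, le_tail_iff hI, le_tail_iff hI]
          refine ⟨fun ⟨h1, h2⟩ => ⟨⟨h1, fun i hi => h2 i (lt_trans hi (Nat.lt_succ_self n))⟩,
            h2 n (Nat.lt_succ_self n) (Nat.lt_succ_iff.1 h)⟩, fun ⟨⟨h1, h2⟩, h3⟩ => ⟨h1, ?_⟩⟩
          intro i hi hγi
          rcases (Nat.lt_succ_iff.1 hi).lt_or_eq with h' | rfl
          · exact h2 i h' hγi
          · exact h3
        rw [this]
        exact ih.2 β γ hβγ (Nat.lt_succ_iff.1 h)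
      · rw [tail_Iio_self hI]; exact hxU β
  obtain ⟨z, hzL, hzx, hzlub, hzU⟩ := exists_isLUB_tails hc hI hL hLc (x := x) (y := y)
    (fun n => (hEL n (hgood n).1).1) (W := U) fun β γ δ h1 h2 => (hgood δ).2 β γ h1 h2
  refine ⟨y, fun n => (hgood n).1, z, hzL, hzx, ⟨fun b hb => ?_, fun b hb => hzlub.2 ?_⟩, hzU⟩
  · obtain ⟨γ, hγ⟩ := eventually_atTop.1 hb
    exact le_trans ((le_tail_iff hI).2 ⟨(hγ γ le_rfl).trans (hEL γ (hgood γ).1).2,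
      fun i _ hi => hγ i hi⟩) (hzlub.1 ⟨γ, rfl⟩)
  · rintro _ ⟨γ, rfl⟩
    exact hb (eventually_atTop.2 ⟨γ, fun i hi => ((le_tail_iff hI).1 le_rfl).2 i trivial hi⟩)

end Sequence

end TopologizedSemilattice

/-! ### From countable to arbitrary families of closed sets. -/

namespace TopologizedSemilattice

open Set Filter Topology

universe u

variable {X : Type u} [SemilatticeInf X] [TopologicalSpace X] [T2Space X]

open Cardinal in
/-- A shift-stable family of closed sets containing `x` whose countable subfamilies have a common
point in `L` below `x` has a common point in `L` below `x`. -/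
theorem exists_mem_iInter_of_shift
    (hc : IsCompleteSemilattice X) (hs : IsSemitopological X)
    {L : Set X} (hL : IsLowerSet L) (hLc : ChainSupClosed L) {x : X} {𝒦 : Set (Set X)}
    (hcl : ∀ K ∈ 𝒦, IsClosed K) (hx : ∀ K ∈ 𝒦, x ∈ K)
    (hshift : ∀ K ∈ 𝒦, ∀ p ∈ K, p ≤ x → ∃ K' ∈ 𝒦, ∀ y ∈ K', p ⊓ y ∈ K)
    (hcount : ∀ F ⊆ 𝒦, F.Countable → ∃ z ∈ L, z ≤ x ∧ ∀ K ∈ F, z ∈ K) :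
    ∀ (c : Cardinal.{u}) (ι : Type u) (K : ι → Set X), #ι = c → (∀ i, K i ∈ 𝒦) →
      ∃ z ∈ L, z ≤ x ∧ ∀ i, z ∈ K i := by
  have : Nonempty X := ⟨x⟩
  choose! I hI using fun (A : Set X) (hA : A.Nonempty) => hc.exists_isGLB hs hA
  intro c
  induction c using WellFoundedLT.induction with
  | ind c ih =>
  intro ι' K' hιc hK'
  rcases le_or_gt c ℵ₀ with hcc | hcc
  · have : Countable ι' := by rw [← mk_le_aleph0_iff, hιc]; exact hcc
    obtain ⟨z, hzL, hzx, hz⟩ := hcount (range K') (by rintro _ ⟨i, rfl⟩; exact hK' i)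
      (countable_range K')
    exact ⟨z, hzL, hzx, fun i => hz _ ⟨i, rfl⟩⟩
  obtain ⟨e⟩ : Nonempty (c.ord.ToType ≃ ι') := by
    rw [← Cardinal.eq, mk_ord_toType, hιc]
  let ι := c.ord.ToType
  let K : ι → Set X := fun i => K' (e i)
  have hK : ∀ i, K i ∈ 𝒦 := fun i => hK' _
  suffices H : ∃ z ∈ L, z ≤ x ∧ ∀ i : ι, z ∈ K i by
    obtain ⟨z, hzL, hzx, hz⟩ := H
    exact ⟨z, hzL, hzx, fun i => by simpa [K] using hz (e.symm i)⟩
  have hne : Nonempty ι := by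
    rw [← mk_ne_zero_iff, mk_ord_toType]
    exact (aleph0_pos.trans hcc).ne'
  have hIic : ∀ i : ι, #(Iic i) < c := fun i => by
    have h1 : #(Iio i) < c := (mk_Iio_lt i (by simp [ι])).trans_eq (mk_ord_toType c)
    rw [← Iio_insert]
    exact mk_insert_le.trans_lt (add_lt_of_lt hcc.le h1 (one_lt_aleph0.trans hcc))
  obtain ⟨y, hy⟩ := exists_wellFounded_choice (ι := ι) fun n f z => z ∈ L ∧
    ∀ β γ, β ≤ γ → γ ≤ n → I (insert x {w | ∃ i, ∃ h : i < n, γ ≤ i ∧ f i h = w}) ⊓ z ∈ K β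
  have hset : ∀ γ n, {w | ∃ i, ∃ _ : i < n, γ ≤ i ∧ y i = w} =
      {w | ∃ i ∈ Iio n, γ ≤ i ∧ y i = w} := fun γ n => by
    ext; simp [and_left_comm]
  simp only [hset] at hy
  change ∀ n, (∃ z, z ∈ L ∧ ∀ β γ, β ≤ γ → γ ≤ n → I (tailSet x y γ (Iio n)) ⊓ z ∈ K β) →
    (y n ∈ L ∧ ∀ β γ, β ≤ γ → γ ≤ n → I (tailSet x y γ (Iio n)) ⊓ y n ∈ K β) at hy
  have hgood : ∀ n, y n ∈ L ∧
      ∀ β γ, β ≤ γ → γ ≤ n → I (tailSet x y γ (Iio n)) ⊓ y n ∈ K β := by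
    intro n
    induction n using WellFoundedLT.induction with
    | ind n ihn =>
    refine hy n ?_
    have hp : ∀ β γ, β ≤ γ → γ ≤ n → I (tailSet x y γ (Iio n)) ∈ K β := by
      intro β γ hβγ hγ
      rcases hγ.lt_or_eq with h | rfl
      · have := tail_mem_closure hc hI (x := x) (y := y)
          (W := K) (isLowerSet_Iio n) (fun β γ δ hδ h1 h2 => (ihn δ hδ).2 β γ h1 h2) hβγ h
        exact (hcl _ (hK β)).closure_eq ▸ this
      · rw [tail_Iio_self hI]
        exact hx _ (hK β)
    -- Shift-stability turns each condition on `y n` into membership in some `Q p` from the family.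
    -- There are fewer than `c` pairs `p`, so the induction hypothesis on cardinals satisfies all of
    -- them at once.
    choose! Q hQ hQK using fun (p : Iic n × Iic n) (h : p.1.1 ≤ p.2.1) =>
      hshift (K p.1.1) (hK _) _ (hp p.1.1 p.2.1 h p.2.2) ((le_tail_iff hI).1 le_rfl).1
    have hlt : #{p : Iic n × Iic n // p.1.1 ≤ p.2.1} < c :=
      (mk_subtype_le _).trans_lt (by
        rw [← mul_def]
        exact mul_lt_of_lt hcc.le (hIic n) (hIic n))
    obtain ⟨z, hzL, hzx, hz⟩ := ih _ hlt _ (fun p => Q p.1) rfl fun p => hQ p.1 p.2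
    exact ⟨z, hzL, fun β γ hβγ hγ =>
      hQK (⟨β, hβγ.trans hγ⟩, ⟨γ, hγ⟩) hβγ z (hz ⟨(⟨β, hβγ.trans hγ⟩, ⟨γ, hγ⟩), hβγ⟩)⟩
  obtain ⟨z, hzL, hzx, -, hz⟩ := exists_isLUB_tails hc hI hL hLc (x := x) (y := y)
    (fun n => (hgood n).1) (W := K) fun β γ δ h1 h2 => (hgood δ).2 β γ h1 h2
  exact ⟨z, hzL, hzx, fun i => (hcl _ (hK i)).closure_eq ▸ hz i⟩

omit [T2Space X] in
theorem mem_closure_inter_Iic (hs : IsSemitopological X) {L : Set X} (hL : IsLowerSet L) {x : X}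
    (hx : x ∈ closure L) : x ∈ closure (L ∩ Iic x) := by
  have := map_mem_closure (t := L ∩ Iic x) (hs x) hx fun y hy =>
    ⟨hL inf_le_right hy, inf_le_left⟩
  rwa [inf_idem] at this

/-- A criterion for a point of the closure of a chain-complete lower set to lie in that set. -/
theorem mem_of_mem_closure_of_shift
    (hc : IsCompleteSemilattice X) (hs : IsSemitopological X)
    {L : Set X} (hL : IsLowerSet L) (hLc : ChainSupClosed L) {x : X} (hxL : x ∈ closure L)
    {𝒦 : Set (Set X)}
    (hcl : ∀ K ∈ 𝒦, IsClosed K) (hx : ∀ K ∈ 𝒦, x ∈ K)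
    (hshift : ∀ K ∈ 𝒦, ∀ p ∈ K, p ≤ x → ∃ K' ∈ 𝒦, ∀ y ∈ K', p ⊓ y ∈ K)
    (hnhds : ∀ K ∈ 𝒦, ∃ V : Set (Set X), V.Countable ∧ (∀ U ∈ V, IsOpen U ∧ x ∈ U) ∧
      ⋂ U ∈ V, closure U ⊆ K)
    (hsep : ∀ z, (∀ K ∈ 𝒦, z ∈ K) → z = x) : x ∈ L := by
  have hcount : ∀ F ⊆ 𝒦, F.Countable → ∃ z ∈ L, z ≤ x ∧ ∀ K ∈ F, z ∈ K := by
    intro F hF hFc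
    choose! V hVc hV hVK using hnhds
    have hcV : (insert univ (⋃ K ∈ F, V K)).Countable :=
      (hFc.biUnion fun K hK => hVc K (hF hK)).insert _
    obtain ⟨U, hU⟩ := hcV.exists_eq_range (insert_nonempty _ _)
    have hU' : ∀ n, IsOpen (U n) ∧ x ∈ U n := by
      intro n
      have : U n ∈ insert univ (⋃ K ∈ F, V K) := hU ▸ mem_range_self n
      rcases this with h | h
      · rw [h]; exact ⟨isOpen_univ, trivial⟩
      · simp only [mem_iUnion] at h
        obtain ⟨K, hK, h⟩ := h
        exact hV K (hF hK) _ h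
    have : NeBot (𝓝[L ∩ Iic x] x) :=
      mem_closure_iff_nhdsWithin_neBot.1 (mem_closure_inter_Iic hs hL hxL)
    obtain ⟨y, -, z, hzL, hzx, -, hz⟩ := exists_sequence_isLUB_mem_closure hc hs hL hLc
      (G := 𝓝[L ∩ Iic x] x) nhdsWithin_le_nhds (E := fun _ => L ∩ Iic x)
      (fun _ => self_mem_nhdsWithin) (fun _ => Subset.rfl)
      (fun n => (hU' n).1) (fun n => (hU' n).2)
    refine ⟨z, hzL, hzx, fun K hK => hVK K (hF hK) (mem_iInter₂.2 fun W hW => ?_)⟩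
    have : W ∈ range U := hU ▸ Or.inr (mem_biUnion hK hW)
    obtain ⟨n, rfl⟩ := this
    exact hz n
  obtain ⟨z, hzL, -, hz⟩ := exists_mem_iInter_of_shift hc hs hL hLc hcl hx hshift hcount _ 𝒦
    Subtype.val rfl Subtype.property
  rw [← hsep z fun K hK => hz ⟨K, hK⟩]
  exact hzL

end TopologizedSemilattice

/-! ### Closedness of Scott-closed sets under separation or joint continuity. -/

namespace TopologizedSemilattice

open Set Filter Topology

universe u

section Separation

/-- Evaluation embeds the points into a power of `ℝ`, which is regular, so a single closed
neighbourhood suffices. -/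
theorem IsFunctionallyHausdorff.isVecT2Delta {X : Type u} [TopologicalSpace X]
    (h : IsFunctionallyHausdorff X) : IsVecT2Delta X := by
  refine ⟨C(X, ℝ) → ℝ, inferInstance, ⟨inferInstance, fun U y hU hy => ?_⟩,
    fun x f => f x, continuous_pi fun f => f.continuous, fun x y hxy => ?_⟩
  · obtain ⟨N, hN, hNc, hNU⟩ := exists_mem_nhds_isClosed_subset (hU.mem_nhds hy)
    exact ⟨{N}, countable_singleton N, by simpa using ⟨hNc, hN⟩, by simpa using hNU⟩
  · by_contra hne
    obtain ⟨f, hf, hfxy⟩ := h x y hne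
    exact hfxy (congrFun hxy ⟨f, hf⟩)

/-- In a `T_{2δ}`-space every neighbourhood `W` of `y` contains the intersection of a countable
family of open neighbourhoods of `y` which equals the intersection of their closures. -/
theorem IsT2Delta.exists_countable_nhds {Y : Type*} [TopologicalSpace Y] (h : IsT2Delta Y) {y : Y}
    {W : Set Y} (hW : IsOpen W) (hy : y ∈ W) :
    ∃ V : Set (Set Y), V.Countable ∧ (∀ U ∈ V, IsOpen U ∧ y ∈ U) ∧ W ∈ V ∧
      ⋂ U ∈ V, closure U ⊆ ⋂₀ V := by
  have hN : ∀ U : Set Y, IsOpen U → y ∈ U → ∃ N : ℕ → Set Y,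
      (∀ n, IsClosed (N n) ∧ N n ∈ 𝓝 y) ∧ ⋂ n, N n ⊆ U := by
    intro U hU hyU
    obtain ⟨F, hFc, hF, hFU⟩ := h.2 U y hU hyU
    obtain ⟨N, hN⟩ := (hFc.insert univ).exists_eq_range (insert_nonempty _ _)
    refine ⟨N, fun n => ?_, fun z hz => hFU fun S hS => ?_⟩
    · have : N n ∈ insert univ F := hN ▸ mem_range_self n
      rcases this with h | h
      · rw [h]; exact ⟨isClosed_univ, univ_mem⟩
      · exact hF _ h
    · have : S ∈ range N := hN ▸ Or.inr hS
      obtain ⟨n, rfl⟩ := this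
      exact mem_iInter.1 hz n
  choose! N hN hNU using hN
  -- Iterate along finite words: the closures of the `T (n :: l)`, over all `n`, meet inside `T l`.
  let T : List ℕ → Set Y := fun l => l.rec W fun n _ S => interior (N S n)
  have hT : ∀ l, IsOpen (T l) ∧ y ∈ T l := by
    intro l
    induction l with
    | nil => exact ⟨hW, hy⟩
    | cons n l ih => exact ⟨isOpen_interior, mem_interior_iff_mem_nhds.2 (hN _ ih.1 ih.2 n).2⟩
  refine ⟨range T, countable_range T, by rintro _ ⟨l, rfl⟩; exact hT l, ⟨[], rfl⟩, ?_⟩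
  rintro z hz _ ⟨l, rfl⟩
  refine hNU _ (hT l).1 (hT l).2 (mem_iInter.2 fun n => ?_)
  exact closure_minimal interior_subset (hN _ (hT l).1 (hT l).2 n).1
    (mem_iInter₂.1 hz (T (n :: l)) ⟨n :: l, rfl⟩)

end Separation

variable {X : Type u} [SemilatticeInf X] [TopologicalSpace X] [T2Space X]

/-- The shift-stable family consists of countable intersections of open neighbourhoods that equal
the intersection of the closures. Preimages under `p ⊓ ·` preserve this form, so separate continuity
is enough. -/
theorem isClosed_of_isVecT2Delta
    (hc : IsCompleteSemilattice X) (hs : IsSemitopological X) (hX : IsVecT2Delta X)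
    {L : Set X} (hL : IsLowerSet L) (hLc : ChainSupClosed L) : IsClosed L := by
  obtain ⟨Y, _, hY, f, hf, hinj⟩ := hX
  refine isClosed_of_closure_subset fun x hx => ?_
  refine mem_of_mem_closure_of_shift hc hs hL hLc hx
    (𝒦 := {K | ∃ V : Set (Set X), V.Countable ∧ (∀ U ∈ V, IsOpen U ∧ x ∈ U) ∧ K = ⋂₀ V ∧
      ⋂ U ∈ V, closure U ⊆ ⋂₀ V}) ?_ ?_ ?_ ?_ ?_
  · rintro _ ⟨V, -, hV, rfl, hVc⟩
    have : ⋂₀ V = ⋂ U ∈ V, closure U := by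
      refine Subset.antisymm (fun z hz => mem_iInter₂.2 fun U hU => subset_closure (hz U hU)) hVc
    rw [this]
    exact isClosed_biInter fun _ _ => isClosed_closure
  · rintro _ ⟨V, -, hV, rfl, -⟩ U hU
    exact (hV U hU).2
  · rintro _ ⟨V, hVc, hV, rfl, hVcl⟩ p hp hpx
    refine ⟨_, ⟨(fun U => (fun y => p ⊓ y) ⁻¹' U) '' V, hVc.image _, ?_, rfl, ?_⟩, ?_⟩
    · rintro _ ⟨U, hU, rfl⟩
      refine ⟨(hV U hU).1.preimage (hs p), ?_⟩
      rw [mem_preimage, inf_eq_left.2 hpx]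
      exact hp U hU
    · rintro z hz _ ⟨U, hU, rfl⟩
      refine hVcl (mem_iInter₂.2 fun U hU => ?_) U hU
      exact (hs p).closure_preimage_subset U (mem_iInter₂.1 hz _ ⟨U, hU, rfl⟩)
    · intro y hy U hU
      exact hy _ ⟨U, hU, rfl⟩
  · rintro _ ⟨V, hVc, hV, rfl, hVcl⟩
    exact ⟨V, hVc, hV, hVcl⟩
  · intro z hz
    by_contra hne
    have := hY.1
    obtain ⟨V, hVc, hV, hWV, hVcl⟩ := hY.exists_countable_nhds (W := {f z}ᶜ) (y := f x)
      isOpen_compl_singleton (fun h => hne (hinj h.symm))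
    refine hz (⋂₀ ((fun U => f ⁻¹' U) '' V)) ⟨_, hVc.image _, ?_, rfl, ?_⟩ _ ⟨_, hWV, rfl⟩ rfl
    · rintro _ ⟨U, hU, rfl⟩
      exact ⟨(hV U hU).1.preimage hf, (hV U hU).2⟩
    · rintro w hw _ ⟨U, hU, rfl⟩
      refine hVcl (mem_iInter₂.2 fun U hU => ?_) U hU
      exact hf.closure_preimage_subset U (mem_iInter₂.1 hw _ ⟨U, hU, rfl⟩)

/-- Since `U (n + 1) ⊓ U (n + 1) ⊆ U n`, joint continuity makes each `K` a subsemilattice, so `K`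
serves as its own shift. -/
theorem isClosed_of_continuousInf [ContinuousInf X]
    (hc : IsCompleteSemilattice X) (hs : IsSemitopological X)
    {L : Set X} (hL : IsLowerSet L) (hLc : ChainSupClosed L) : IsClosed L := by
  refine isClosed_of_closure_subset fun x hx => ?_
  refine mem_of_mem_closure_of_shift hc hs hL hLc hx
    (𝒦 := {K | ∃ U : ℕ → Set X, (∀ n, IsOpen (U n) ∧ x ∈ U n) ∧
      (∀ n, ∀ a ∈ U (n + 1), ∀ b ∈ U (n + 1), a ⊓ b ∈ U n) ∧ K = ⋂ n, closure (U n)})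
    ?_ ?_ ?_ ?_ ?_
  · rintro _ ⟨U, -, -, rfl⟩
    exact isClosed_iInter fun _ => isClosed_closure
  · rintro _ ⟨U, hU, -, rfl⟩
    exact mem_iInter.2 fun n => subset_closure (hU n).2
  · rintro _ ⟨U, hU, hUU, rfl⟩ p hp _
    refine ⟨_, ⟨U, hU, hUU, rfl⟩, fun y hy => mem_iInter.2 fun n => ?_⟩
    exact map_mem_closure₂ continuous_inf (mem_iInter.1 hp (n + 1)) (mem_iInter.1 hy (n + 1))
      (hUU n)
  · rintro _ ⟨U, hU, hUU, rfl⟩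
    refine ⟨range U, countable_range U, by rintro _ ⟨n, rfl⟩; exact hU n, fun z hz => ?_⟩
    exact mem_iInter.2 fun n => mem_iInter₂.1 hz _ ⟨n, rfl⟩
  · intro z hz
    by_contra hne
    obtain ⟨A, W, hA, hW, hzA, hxW, hAW⟩ := t2_separation hne
    have hstep : ∀ U : Set X, IsOpen U → x ∈ U →
        ∃ V, (IsOpen V ∧ x ∈ V) ∧ ∀ a ∈ V, ∀ b ∈ V, a ⊓ b ∈ U := by
      intro U hU hxU
      have h1 : (fun p : X × X => p.1 ⊓ p.2) ⁻¹' U ∈ 𝓝 (x, x) :=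
        (hU.preimage continuous_inf).mem_nhds (by simpa using hxU)
      obtain ⟨V, V', hV, hxV, hV', hxV', hVU⟩ := mem_nhds_prod_iff'.1 h1
      exact ⟨V ∩ V', ⟨hV.inter hV', hxV, hxV'⟩, fun a ha b hb => hVU (mk_mem_prod ha.1 hb.2)⟩
    choose! S hS hSS using hstep
    let U : ℕ → Set X := fun n => n.rec W fun _ V => S V
    have hU : ∀ n, IsOpen (U n) ∧ x ∈ U n := by
      intro n
      induction n with
      | zero => exact ⟨hW, hxW⟩
      | succ n ih => exact hS _ ih.1 ih.2
    have hzK := mem_iInter.1 (hz _ ⟨U, hU, fun n => hSS _ (hU n).1 (hU n).2, rfl⟩) 0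
    exact (disjoint_left.1 (hAW.closure_right hA)) hzA hzK

end TopologizedSemilattice

/-! ### Closedness of Scott-closed sets in sequential spaces. -/

namespace TopologizedSemilattice

open Set Filter Topology

/-- Sequential spaces have countable tightness. -/
theorem _root_.SequentialSpace.exists_countable_mem_closure {X : Type*} [TopologicalSpace X]
    [SequentialSpace X] {A : Set X} {x : X} (hx : x ∈ closure A) :
    ∃ B ⊆ A, B.Countable ∧ x ∈ closure B := by
  have hcl : IsClosed {z | ∃ B ⊆ A, B.Countable ∧ z ∈ closure B} := by
    refine IsSeqClosed.isClosed fun u z hu hz => ?_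
    choose B hBA hBc hB using hu
    refine ⟨⋃ n, B n, iUnion_subset hBA, countable_iUnion hBc, ?_⟩
    exact isClosed_closure.mem_of_tendsto hz
      (Eventually.of_forall fun n => closure_mono (subset_iUnion B n) (hB n))
  have hA : A ⊆ {z | ∃ B ⊆ A, B.Countable ∧ z ∈ closure B} := fun a ha =>
    ⟨{a}, by simpa using ha, countable_singleton a, subset_closure rfl⟩
  exact closure_minimal hA hcl hx

variable {X : Type*} [SemilatticeInf X] [TopologicalSpace X] [T2Space X]

theorem isClosed_of_sequentialSpace [SequentialSpace X]
    (hc : IsCompleteSemilattice X) (hs : IsSemitopological X)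
    {L : Set X} (hL : IsLowerSet L) (hLc : ChainSupClosed L) : IsClosed L := by
  refine IsSeqClosed.isClosed fun u x hu hx => ?_
  have hexists : ∀ G : Filter X, NeBot G → (∀ᶠ y in G, y ≤ x) →
      ∃ z, IsLUB {b | ∀ᶠ y in G, b ≤ y} z := fun G _ hGx =>
    hc.exists_isLUB hs ⟨x, fun b hb => by
      obtain ⟨y, h1, h2⟩ := (Eventually.and hb hGx).exists
      exact h1.trans h2⟩
  let G₀ : Filter X := map (fun n => x ⊓ u n) atTop
  have hG₀ : G₀ ≤ 𝓝 x := by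
    have := ((hs x).tendsto x).comp hx
    rwa [inf_idem] at this
  have hG₀L : L ∩ Iic x ∈ G₀ :=
    mem_map.2 <| Eventually.of_forall fun n => ⟨hL inf_le_right (hu n), inf_le_left⟩
  -- Pairs of a countably generated filter and its limit inferior.
  let P : Set (Filter X × X) := {p | p.1.IsCountablyGenerated ∧ NeBot p.1 ∧ p.1 ≤ G₀ ∧
    IsLUB {b | ∀ᶠ y in p.1, b ≤ y} p.2}
  have hmono : ∀ p ∈ P, ∀ q ∈ P, q.1 ≤ p.1 → p.2 ≤ q.2 := fun p hp q hq h =>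
    hp.2.2.2.2 fun b hb => hq.2.2.2.1 (h hb)
  obtain ⟨z₀, hz₀⟩ := hexists G₀ inferInstance (mem_of_superset hG₀L inter_subset_right)
  have hP₀ : (G₀, z₀) ∈ P := ⟨inferInstance, inferInstance, le_rfl, hz₀⟩
  -- Refining the filter counts as progress only if the limit inferior strictly grows.
  let r : P → P → Prop := fun p q => p = q ∨ (q.1.1 ≤ p.1.1 ∧ p.1.2 < q.1.2)
  have htrans : ∀ {a b c : P}, r a b → r b c → r a c := by
    rintro a b c (rfl | ⟨h1, h2⟩) (rfl | ⟨h3, h4⟩)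
    · exact Or.inl rfl
    · exact Or.inr ⟨h3, h4⟩
    · exact Or.inr ⟨h1, h2⟩
    · exact Or.inr ⟨h3.trans h1, h2.trans h4⟩
  have hbound : ∀ c : Set P, IsChain r c → ∃ ub, ∀ a ∈ c, r a ub := by
    intro c hcr
    rcases c.eq_empty_or_nonempty with rfl | hne
    · exact ⟨⟨_, hP₀⟩, by simp⟩
    have htot : ∀ a ∈ c, ∀ b ∈ c, r a b ∨ r b a := fun a ha b hb => by
      by_cases hab : a = b
      · exact Or.inl (Or.inl hab)
      · exact hcr ha hb hab
    have hch : IsChain (· ≤ ·) ((fun p : P => p.1.2) '' c) := by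
      rw [isChain_iff_le]
      rintro _ ⟨a, ha, rfl⟩ _ ⟨b, hb, rfl⟩
      rcases htot a ha b hb with (rfl | h) | (rfl | h)
      · exact Or.inl le_rfl
      · exact Or.inl h.2.le
      · exact Or.inl le_rfl
      · exact Or.inr h.2.le
    obtain ⟨-, s, hscl, hslub⟩ := hc _ (hne.image _) hch
    by_cases hmax : ∃ a ∈ c, a.1.2 = s
    · obtain ⟨a, ha, rfl⟩ := hmax
      refine ⟨a, fun b hb => (htot b hb a ha).elim id ?_⟩
      rintro (rfl | h)
      · exact Or.inl rfl
      · exact absurd (hslub.1 ⟨b, hb, rfl⟩) (not_le_of_gt h.2)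
    -- Countable tightness replaces the chain by countably many members, so the infimum of their
    -- filters stays countably generated.
    obtain ⟨B, hB, hBc, hsB⟩ := SequentialSpace.exists_countable_mem_closure hscl
    have hBne : Nonempty B := (closure_nonempty_iff.1 ⟨s, hsB⟩).to_subtype
    have : Countable B := hBc.to_subtype
    choose F hFc hFB using fun b : B => hB b.2
    let G : Filter X := ⨅ b, (F b).1.1
    have hGc : G.IsCountablyGenerated := by
      have : ∀ b, (F b).1.1.IsCountablyGenerated := fun b => (F b).2.1
      infer_instance
    have hGn : NeBot G := by
      refine iInf_neBot_of_directed' (fun a b => ?_) fun b => (F b).2.2.1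
      rcases htot _ (hFc a) _ (hFc b) with h | h
      · refine ⟨b, ?_, le_rfl⟩
        rcases h with h | h
        · rw [h]
        · exact h.1
      · refine ⟨a, le_rfl, ?_⟩
        rcases h with h | h
        · rw [h]
        · exact h.1
    have hGG₀ : G ≤ G₀ := (iInf_le _ hBne.some).trans (F hBne.some).2.2.2.1
    obtain ⟨z, hz⟩ := hexists G hGn (hGG₀ (mem_of_superset hG₀L inter_subset_right))
    have hGP : (G, z) ∈ P := ⟨hGc, hGn, hGG₀, hz⟩
    refine ⟨⟨_, hGP⟩, fun a ha => ?_⟩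
    obtain ⟨b, hb⟩ : ∃ b : B, ¬ (b : X) ≤ a.1.2 := by
      by_contra! hle
      refine hmax ⟨a, ha, le_antisymm (hslub.1 ⟨a, ha, rfl⟩) ?_⟩
      exact closure_minimal (fun b hb => hle ⟨b, hb⟩) (hs.isClosed_Iic a.1.2) hsB
    have hFb : (F b).1.2 = b := hFB b
    rcases htot a ha _ (hFc b) with (h | h) | (h | h)
    · exact absurd (h ▸ hFb).ge hb
    · exact Or.inr ⟨(iInf_le _ b).trans h.1,
        h.2.trans_le (hmono _ (F b).2 _ hGP (iInf_le _ b))⟩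
    · exact absurd (h ▸ hFb).ge hb
    · exact absurd (hFb ▸ h.2.le) hb
  obtain ⟨m, hm⟩ := exists_maximal_of_chains_bounded hbound htrans
  obtain ⟨⟨G, z⟩, hGc, hGn, hGG₀, hGz⟩ := m
  obtain ⟨E, hE⟩ := G.exists_antitone_basis
  -- Every sequence refining `G` has limit inferior `z` by maximality, so `z` inherits what the
  -- construction gives for each single `U`.
  have key : ∀ U : Set X, IsOpen U → x ∈ U → z ∈ L ∧ z ∈ closure U := by
    intro U hU hxU
    have hGL : L ∩ Iic x ∈ G := hGG₀ hG₀L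
    obtain ⟨y, hyE, w, hwL, hwx, hw, hwU⟩ := exists_sequence_isLUB_mem_closure hc hs hL hLc
      (hGG₀.trans hG₀) (E := fun n => E n ∩ (L ∩ Iic x))
      (fun n => inter_mem (hE.1.mem_of_mem trivial) hGL) (fun n => inter_subset_right)
      (U := fun _ => U) (fun _ => hU) (fun _ => hxU)
    have hyG : map y atTop ≤ G := hE.tendsto fun n => (hyE n).1
    have hq : (map y atTop, w) ∈ P := ⟨inferInstance, inferInstance, hyG.trans hGG₀, hw⟩
    have hzw : z ≤ w := hmono (G, z) ⟨hGc, hGn, hGG₀, hGz⟩ _ hq hyG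
    have : z = w := by
      by_contra hne
      have hlt := lt_of_le_of_ne hzw hne
      rcases hm ⟨_, hq⟩ (Or.inr ⟨hyG, hlt⟩) with h | h
      · exact hne (congrArg (fun p : P => p.1.2) h).symm
      · exact lt_asymm h.2 hlt
    subst this
    exact ⟨hwL, hwU 0⟩
  have hzx : z = x := by
    by_contra hne
    obtain ⟨A, W, hA, hW, hzA, hxW, hAW⟩ := t2_separation hne
    exact (disjoint_left.1 (hAW.closure_right hA)) hzA (key W hW hxW).2
  rw [← hzx]
  exact (key univ isOpen_univ trivial).1

end TopologizedSemilattice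

/-- Inclusions of topologies are written as inclusions of families of open sets. `Topology.lawson X`
is the topology generated by the Scott-open sets and the complements of the sets `Set.Ici x`. -/
theorem theorem7p6 {X : Type*} [SemilatticeInf X] [τ : TopologicalSpace X] [T2Space X]
    (hsemi : TopologizedSemilattice.IsSemitopological X)
    (hcomplete : TopologizedSemilattice.IsCompleteSemilattice X)
    (hX : ContinuousInf X ∨ SequentialSpace X ∨ TopologizedSemilattice.IsVecT2Delta X ∨
      TopologizedSemilattice.IsFunctionallyHausdorff X) :
    {U | IsOpen[TopologizedSemilattice.intervalWeakTopology X] U} ⊆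
        {U : Set X | IsOpen[Topology.lawson X] U} ∧
      {U | IsOpen[Topology.lawson X] U} ⊆
        {U : Set X | IsOpen[TopologizedSemilattice.zariskiTopology X] U} ∧
      {U | IsOpen[TopologizedSemilattice.zariskiTopology X] U} ⊆
        {U : Set X | IsOpen[τ] U} := by
  open TopologizedSemilattice in
  have hclosed : ∀ L : Set X, IsLowerSet L → DirSupClosed L → IsClosed L := by
    intro L hL hLd
    have hLc := hLd.chainSupClosed
    rcases hX with h | h | h | h
    · exact isClosed_of_continuousInf hcomplete hsemi hL hLc
    · exact isClosed_of_sequentialSpace hcomplete hsemi hL hLc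
    · exact isClosed_of_isVecT2Delta hcomplete hsemi h hL hLc
    · exact isClosed_of_isVecT2Delta hcomplete hsemi h.isVecT2Delta hL hLc
  exact ⟨hcomplete.lawson_le_intervalWeakTopology hsemi,
    TopologizedSemilattice.zariskiTopology_le_lawson hsemi hclosed,
    TopologizedSemilattice.le_zariskiTopology⟩
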